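/- \textbf{Setting.} Let $\beta$ be a nonzero integer (for the compactified $c=1$ string, $\beta=1,2,\dots$), let $\hbar\in\mathbb C\setminus\{0\}$, fix a branch $\ell$ of $\log(-\hbar)$ and put $(-\hbar)^a=e^{a\ell}$. Assume that no Gamma function below is evaluated at a pole: $\frac12-\frac1\hbar\notin\{0,-1,-2,\dots\}$ and $\frac12-\frac1\hbar+\frac{i+1/2}{\beta}\notin\{0,-1,-2,\dots\}$ for all $i\in\mathbb Z$. On the lattice $s\in\hbar\mathbb Z$, with $s=\hbar i$, let $\mathbf\Lambda=(\delta_{i,j-1})_{i,j\in\mathbb Z}$ be the matrix of the shift $e^{\hbar\partial_s}$ and $\mathbf\Delta=(i\,\delta_{ij})_{i,j\in\mathbb Z}$, so that multiplication by $s$ is $\hbar\mathbf\Delta$. Time-dependent operators are formal power series in the times $t=(t_1,t_2,\dots)$, $\bar t=(\bar t_1,\bar t_2,\dots)$ whose coefficients are $\mathbb Z\times\mathbb Z$ complex matrices with finite columns; they form a ring. Let $\mathbf U(0,0)$ be the diagonal matrix with entries $$u_{ii}=(-\hbar)^{(i+\frac12)/\beta}\,\frac{\Gamma\bigl(\frac12-\frac1\hbar+\frac{i+1/2}{\beta}\bigr)}{\Gamma\bigl(\frac12-\frac1\hbar\bigr)},$$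 and $$\mathbf U(t,\bar t)=\exp\Bigl(\hbar^{-1}\sum_{n\ge1}t_n\mathbf\Lambda^n\Bigr)\,\mathbf U(0,0)\,\exp\Bigl(-\hbar^{-1}\sum_{n\ge1}\bar t_n\mathbf\Lambda^{-n}\Bigr).$$ \textbf{Theorem.} There is exactly one pair $(W,\bar W)$ of invertible time-dependent operators with $W$ lower triangular with unit diagonal, $\bar W$ upper triangular, and $\mathbf U(t,\bar t)=W^{-1}\bar W$; these are the dressing operators of the solution of the $\hbar$-dependent Toda lattice hierarchy determined by $\mathbf U(0,0)$. Its Lax and Orlov--Shulman operators $$L=W\mathbf\Lambda W^{-1},\qquad M=W\Bigl(\hbar\mathbf\Delta+\sum_{n\ge1}n t_n\mathbf\Lambda^n\Bigr)W^{-1},$$ $$\bar L=\bar W\mathbf\Lambda\bar W^{-1},\qquad \bar M=\bar W\Bigl(\hbar\mathbf\Delta-\sum_{n\ge1}n\bar t_n\mathbf\Lambda^{-n}\Bigr)\bar W^{-1}$$ obey the string equations $$L^\beta=\Bigl(-\frac1\beta\bar M-\hbar\frac{\beta+1}{2\beta}+1\Bigr)\bar L^\beta,\qquad \bar L^{-\beta}=\Bigl(-\frac1\beta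 M+\hbar\frac{\beta-1}{2\beta}+1\Bigr)L^{-\beta}.$$ -/

import Mathlib

noncomputable section

namespace TodaString

/-- Finitely supported functions of the lattice coordinate `i = s / ħ ∈ ℤ`. The basis vector
`Finsupp.single j 1` is the `j`-th unit column vector. -/
abbrev LatticeFun : Type := ℤ →₀ ℂ

/-- Time-independent operators on the lattice; equivalently `ℤ × ℤ` matrices all of whose columns
are finite (every difference operator of finite order is one). -/
abbrev LatticeOp : Type := Module.End ℂ LatticeFun

/-- Names of the time variables: `Sum.inl n` is `t_n`, `Sum.inr n` is `t̄_n` (`n = 1, 2, …`). -/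
abbrev Time : Type := ℕ+ ⊕ ℕ+

/-- The ring of time-dependent operators: formal power series in all the times `t_n`, `t̄_n`
with coefficients in the lattice operators. -/
abbrev TodaOp : Type := MvPowerSeries Time LatticeOp

/-- The matrix entry `A_{ij}` of a time-dependent operator, a formal power series in the times. -/
def entry (A : TodaOp) (i j : ℤ) : MvPowerSeries Time ℂ :=
  fun m => (MvPowerSeries.coeff m A) (Finsupp.single j 1) i

/-- The shift `e^{ħ ∂_s}`, `(Λ f)(i) = f (i + 1)`, as an invertible lattice operator. As a matrix,
`Λ_{ij} = δ_{i, j - 1}`. -/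
def latticeShift : LatticeOpˣ :=
  LinearMap.GeneralLinearGroup.ofLinearEquiv
    (Finsupp.domLCongr (R := ℂ) (M := ℂ) (Equiv.subRight (1 : ℤ)))

/-- The diagonal matrix `(d_i δ_{ij})`, that is, multiplication by the function `d`. -/
def latticeDiag (d : ℤ → ℂ) : LatticeOp :=
  Finsupp.lsum ℂ fun j : ℤ => d j • Finsupp.lsingle j

/-- The matrix `Λ` as an invertible time-dependent operator (constant in the times). -/
def shift : TodaOpˣ := Units.map (MvPowerSeries.C (σ := Time)).toMonoidHom latticeShift

/-- The time-independent operator `diag(d_i)` as a time-dependent operator. -/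
def diag (d : ℤ → ℂ) : TodaOp := MvPowerSeries.C (latticeDiag d)

/-- The matrix `Δ = (i δ_{ij})`; multiplication by `s` is `ħ Δ`. -/
def position : TodaOp := diag fun i => (i : ℂ)

/-- The formal series `∑_x x · c x` over all time variables `x`: the coefficient of the monomial `x`
is `c x`, all other coefficients vanish. -/
def linearSeries (c : Time → LatticeOp) : TodaOp :=
  fun m => ∑ x ∈ m.support, if m = Finsupp.single x 1 then c x else 0

/-- `∑_{n ≥ 1} a n · t_n Λ^n`. -/
def tSeries (a : ℕ+ → ℂ) : TodaOp :=
  linearSeries (Sum.elim (fun n => a n • ((latticeShift ^ (n : ℤ) : LatticeOpˣ) : LatticeOp)) 0)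

/-- `∑_{n ≥ 1} a n · t̄_n Λ^{-n}`. -/
def tbarSeries (a : ℕ+ → ℂ) : TodaOp :=
  linearSeries (Sum.elim 0 (fun n => a n • ((latticeShift ^ (-(n : ℤ)) : LatticeOpˣ) : LatticeOp)))

/-- The exponential `∑_k X^k / k!` of a formal series `X` without constant term. Then `X^k` has no
monomials of degree less than `k`, so only `k ≤ deg m` contribute to the coefficient of `m`. -/
def formalExp (X : TodaOp) : TodaOp :=
  fun m => ∑ k ∈ Finset.range (m.degree + 1),
    ((k.factorial : ℂ)⁻¹) • MvPowerSeries.coeff m (X ^ k)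

/-- The time evolution
`U(t, t̄) = exp(ħ⁻¹ ∑ t_n Λ^n) U(0,0) exp(- ħ⁻¹ ∑ t̄_n Λ^{-n})`. -/
def evolve (ħ : ℂ) (U₀ : TodaOp) : TodaOp :=
  formalExp (ħ⁻¹ • tSeries fun _ => 1) * U₀ * formalExp (-(ħ⁻¹ • tbarSeries fun _ => 1))

/-- `(W, W̄)` is the pair of dressing operators of the solution of the `ħ`-dependent Toda lattice
hierarchy determined by the matrix `U(0,0) = U₀`: `W = 1 + ∑_{n ≥ 1} w_n Λ^{-n}` is lower
unitriangular, `W̄ = ∑_{n ≥ 0} w̄_n Λ^n` is upper triangular, and `U(t, t̄) = W⁻¹ W̄`. -/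
structure IsDressing (ħ : ℂ) (U₀ : TodaOp) (W Wbar : TodaOpˣ) : Prop where
  lower : ∀ i j : ℤ, i < j → entry W i j = 0
  diag_one : ∀ i : ℤ, entry W i i = 1
  upper : ∀ i j : ℤ, j < i → entry Wbar i j = 0
  factor : evolve ħ U₀ = ((W⁻¹ : TodaOpˣ) : TodaOp) * (Wbar : TodaOp)

/-- `L = W Λ W⁻¹`; with `W̄` in place of `W` this is `L̄`. -/
def lax (W : TodaOpˣ) : TodaOpˣ := W * shift * W⁻¹

/-- `M = W (ħ Δ + ∑ n t_n Λ^n) W⁻¹`. -/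
def orlovM (ħ : ℂ) (W : TodaOpˣ) : TodaOp :=
  (W : TodaOp) * (ħ • position + tSeries fun n => (n : ℂ)) * ((W⁻¹ : TodaOpˣ) : TodaOp)

/-- `M̄ = W̄ (ħ Δ - ∑ n t̄_n Λ^{-n}) W̄⁻¹`. -/
def orlovMbar (ħ : ℂ) (Wbar : TodaOpˣ) : TodaOp :=
  (Wbar : TodaOp) * (ħ • position - tbarSeries fun n => (n : ℂ)) *
    ((Wbar⁻¹ : TodaOpˣ) : TodaOp)

/-- The diagonal entries
`u_{ii} = (-ħ)^{(i + 1/2)/β} Γ(1/2 - 1/ħ + (i + 1/2)/β) / Γ(1/2 - 1/ħ)`, where the power is formed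
with the branch `ℓ` of `log (-ħ)`. -/
def stringEntry (β : ℤ) (ħ ℓ : ℂ) (i : ℤ) : ℂ :=
  Complex.exp (((i : ℂ) + 1 / 2) / β * ℓ) *
    (Complex.Gamma (1 / 2 - 1 / ħ + ((i : ℂ) + 1 / 2) / β) / Complex.Gamma (1 / 2 - 1 / ħ))

end TodaString

end

noncomputable section

namespace TodaString

open MvPowerSeries Finset

/-! ### Lattice operators -/

/-! Existence and uniqueness are a Gauss decomposition degree by degree in the times. Both
exponentials have constant coefficient 1, so that of `U` is the invertible diagonal matrix `D =
U(0,0)`. The coefficient of `m` in `W U` is `W_m D` plus terms in lower coefficients of `W`;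
requiring its strictly lower part to vanish determines `W_m` (`entry_lowerFactor_mul`,
`eq_of_mul_upper`). Then `W̄ = W U`.

The string equations are dressed forms of one identity at zero times. Since `Γ(z+1) = z Γ(z)`, the
ratio `u_{i+β} / u_i` is affine in `s = ħ i` (`stringEntry_add`), so `Λ^β D = D (affine in s) Λ^β`,
with a companion for `Λ^{-β}`. Both exponentials commute with powers of `Λ`. Moving `s` through them
adds `∑ n t_n Λ^n` on the left or subtracts `∑ n t̄_n Λ^{-n}` on the right, which gives the
undressed `M` and `M̄`. Conjugating with `W U = W̄` yields the equations (`dressed_mul_right`,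
`dressed_mul_left`). -/

theorem latticeOp_ext {A B : LatticeOp}
    (h : ∀ i j : ℤ, A (Finsupp.single j 1) i = B (Finsupp.single j 1) i) : A = B :=
  Finsupp.lhom_ext' fun j => LinearMap.ext_ring <| Finsupp.ext fun i => h i j

theorem latticeDiag_single (d : ℤ → ℂ) (j : ℤ) :
    latticeDiag d (Finsupp.single j 1) = d j • Finsupp.single j 1 := by
  simp [latticeDiag]

theorem latticeDiag_apply (d : ℤ → ℂ) (f : LatticeFun) (i : ℤ) :
    latticeDiag d f i = d i * f i := by
  induction f using Finsupp.induction_linear with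
  | zero => simp
  | add f g hf hg => rw [map_add, Finsupp.add_apply, hf, hg, Finsupp.add_apply, mul_add]
  | single j c =>
    have : Finsupp.single j c = c • Finsupp.single j (1 : ℂ) := by simp
    rw [this, map_smul, latticeDiag_single]
    by_cases h : j = i
    · subst h; simp [mul_comm]
    · simp [Finsupp.single_eq_of_ne' h]

theorem mul_latticeDiag_single (A : LatticeOp) (d : ℤ → ℂ) (i j : ℤ) :
    (A * latticeDiag d) (Finsupp.single j 1) i = d j * A (Finsupp.single j 1) i := by
  rw [Module.End.mul_apply, latticeDiag_single, map_smul, Finsupp.smul_apply, smul_eq_mul]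

theorem latticeDiag_mul (d e : ℤ → ℂ) :
    latticeDiag d * latticeDiag e = latticeDiag fun i => d i * e i :=
  LinearMap.ext fun f => Finsupp.ext fun i => by
    simp only [Module.End.mul_apply, latticeDiag_apply, mul_assoc]

theorem latticeDiag_one : latticeDiag (fun _ => 1) = 1 :=
  LinearMap.ext fun f => Finsupp.ext fun i => by simp [latticeDiag_apply]

theorem latticeDiag_mul_inv {d : ℤ → ℂ} (hd : ∀ i, d i ≠ 0) :
    latticeDiag d * latticeDiag (fun i => (d i)⁻¹) = 1 := by
  simp [latticeDiag_mul, hd, latticeDiag_one]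

theorem latticeDiag_inv_mul {d : ℤ → ℂ} (hd : ∀ i, d i ≠ 0) :
    latticeDiag (fun i => (d i)⁻¹) * latticeDiag d = 1 := by
  simp [latticeDiag_mul, hd, latticeDiag_one]

theorem isUnit_latticeDiag {d : ℤ → ℂ} (hd : ∀ i, d i ≠ 0) : IsUnit (latticeDiag d) :=
  ⟨⟨_, _, latticeDiag_mul_inv hd, latticeDiag_inv_mul hd⟩, rfl⟩

theorem latticeShift_single (j : ℤ) :
    (latticeShift : LatticeOp) (Finsupp.single j 1) = Finsupp.single (j - 1) 1 := by
  change Finsupp.domLCongr (R := ℂ) (M := ℂ) (Equiv.subRight (1 : ℤ)) (Finsupp.single j 1) = _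
  simp

theorem latticeShift_inv_single (j : ℤ) :
    ((latticeShift⁻¹ : LatticeOpˣ) : LatticeOp) (Finsupp.single j 1) =
      Finsupp.single (j + 1) 1 := by
  have h := latticeShift_single (j + 1)
  rw [add_sub_cancel_right] at h
  rw [← h, ← Module.End.mul_apply, Units.inv_mul, Module.End.one_apply]

theorem latticeShift_zpow_single (k j : ℤ) :
    ((latticeShift ^ k : LatticeOpˣ) : LatticeOp) (Finsupp.single j 1) =
      Finsupp.single (j - k) 1 := by
  induction k generalizing j with
  | zero => simp
  | succ n ih =>
    rw [zpow_add_one, Units.val_mul, Module.End.mul_apply, latticeShift_single, ih]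
    congr 1; ring
  | pred n ih =>
    rw [zpow_sub_one, Units.val_mul, Module.End.mul_apply, latticeShift_inv_single, ih]
    congr 1; ring

theorem latticeShift_zpow_mul_latticeDiag (k : ℤ) (d : ℤ → ℂ) :
    ((latticeShift ^ k : LatticeOpˣ) : LatticeOp) * latticeDiag d =
      latticeDiag (fun i => d (i + k)) * ((latticeShift ^ k : LatticeOpˣ) : LatticeOp) :=
  latticeOp_ext fun i j => by
    rw [Module.End.mul_apply, Module.End.mul_apply, latticeDiag_single, map_smul,
      latticeShift_zpow_single, latticeDiag_single, sub_add_cancel]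

/-- `Λ^k` sends column `j` to `j - k`, so the two orders of multiplication give weights `j - k` and
`j`. This is the source of the factors `n` in `M` and `M̄`. -/
theorem latticeDiag_mul_latticeShift_zpow_sub (k : ℤ) :
    latticeDiag (fun i => (i : ℂ)) * ((latticeShift ^ k : LatticeOpˣ) : LatticeOp) -
      ((latticeShift ^ k : LatticeOpˣ) : LatticeOp) * latticeDiag (fun i => (i : ℂ)) =
      -(k : ℂ) • ((latticeShift ^ k : LatticeOpˣ) : LatticeOp) := by
  refine latticeOp_ext fun i j => ?_
  rw [LinearMap.sub_apply, LinearMap.smul_apply, Module.End.mul_apply, Module.End.mul_apply,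
    latticeDiag_single, map_smul, latticeShift_zpow_single, latticeDiag_single, ← sub_smul]
  congr 2
  push_cast; ring

theorem commute_latticeShift_zpow (k l : ℤ) :
    Commute ((latticeShift ^ k : LatticeOpˣ) : LatticeOp)
      ((latticeShift ^ l : LatticeOpˣ) : LatticeOp) :=
  Commute.units_val ((Commute.refl latticeShift).zpow_zpow k l)

/-- The strictly lower triangular part of a lattice operator. -/
def lowerPart (A : LatticeOp) : LatticeOp :=
  Finsupp.lsum ℂ fun j : ℤ =>
    LinearMap.toSpanSingleton ℂ LatticeFun ((A (Finsupp.single j 1)).filter fun i => j < i)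

theorem lowerPart_single (A : LatticeOp) (i j : ℤ) :
    lowerPart A (Finsupp.single j 1) i = if j < i then A (Finsupp.single j 1) i else 0 := by
  simp [lowerPart, Finsupp.filter_apply]

/-! ### Formal power series with operator coefficients -/

theorem commute_of_coeff {σ R : Type*} [Semiring R] {f g : MvPowerSeries σ R}
    (h : ∀ m n, Commute (coeff m f) (coeff n g)) : Commute f g := by
  classical
  refine MvPowerSeries.ext fun n => ?_
  rw [coeff_mul, coeff_mul]
  exact sum_equiv (Equiv.prodComm _ _) (by simp [add_comm]) fun p _ => (h _ _).eq

theorem coeff_linearSeries (c : Time → LatticeOp) (m : Time →₀ ℕ) :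
    coeff m (linearSeries c) = ∑ x ∈ m.support, if m = Finsupp.single x 1 then c x else 0 :=
  rfl

theorem constantCoeff_linearSeries (c : Time → LatticeOp) :
    constantCoeff (linearSeries c) = 0 := by
  rw [← coeff_zero_eq_constantCoeff_apply, coeff_linearSeries]
  simp

theorem C_mul_linearSeries (a : LatticeOp) (c : Time → LatticeOp) :
    C a * linearSeries c = linearSeries fun x => a * c x := by
  refine MvPowerSeries.ext fun m => ?_
  simp only [coeff_C_mul, coeff_linearSeries, mul_sum, mul_ite, mul_zero]

theorem linearSeries_mul_C (a : LatticeOp) (c : Time → LatticeOp) :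
    linearSeries c * C a = linearSeries fun x => c x * a := by
  refine MvPowerSeries.ext fun m => ?_
  simp only [coeff_mul_C, coeff_linearSeries, sum_mul, ite_mul, zero_mul]

theorem coeff_linearSeries_single (c : Time → LatticeOp) (x : Time) :
    coeff (Finsupp.single x 1) (linearSeries c) = c x := by
  rw [coeff_linearSeries, Finsupp.support_single _ one_ne_zero, sum_singleton, if_pos rfl]

theorem coeff_linearSeries_of_ne (c : Time → LatticeOp) {m : Time →₀ ℕ}
    (h : ∀ x, m ≠ Finsupp.single x 1) : coeff m (linearSeries c) = 0 :=
  sum_eq_zero fun x _ => if_neg (h x)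

theorem linearSeries_sub (c c' : Time → LatticeOp) :
    linearSeries c - linearSeries c' = linearSeries fun x => c x - c' x := by
  refine MvPowerSeries.ext fun m => ?_
  rw [map_sub]
  by_cases h : ∃ x, m = Finsupp.single x 1
  · obtain ⟨x, rfl⟩ := h
    simp only [coeff_linearSeries_single]
  · push Not at h
    simp only [coeff_linearSeries_of_ne _ h]
    exact sub_self (0 : LatticeOp)

theorem linearSeries_neg (c : Time → LatticeOp) :
    -linearSeries c = linearSeries fun x => -c x := by
  refine MvPowerSeries.ext fun m => ?_
  rw [map_neg]
  by_cases h : ∃ x, m = Finsupp.single x 1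
  · obtain ⟨x, rfl⟩ := h
    simp only [coeff_linearSeries_single]
  · push Not at h
    simp only [coeff_linearSeries_of_ne _ h]
    exact neg_zero (G := LatticeOp)

theorem commute_linearSeries {c c' : Time → LatticeOp} (h : ∀ x y, Commute (c x) (c' y)) :
    Commute (linearSeries c) (linearSeries c') := by
  refine commute_of_coeff fun m n => ?_
  simp only [coeff_linearSeries]
  refine Commute.sum_left _ _ _ fun x _ => Commute.sum_right _ _ _ fun y _ => ?_
  split_ifs <;> simp [h]

theorem shift_zpow (k : ℤ) :
    ((shift ^ k : TodaOpˣ) : TodaOp) = C ((latticeShift ^ k : LatticeOpˣ) : LatticeOp) := by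
  rw [shift, ← map_zpow]; rfl

theorem commute_latticeShift_zpow_tCoeff (k : ℤ) (a : ℕ+ → ℂ) (x : Time) :
    Commute ((latticeShift ^ k : LatticeOpˣ) : LatticeOp)
      (Sum.elim (fun n : ℕ+ => a n • ((latticeShift ^ (n : ℤ) : LatticeOpˣ) : LatticeOp))
        (0 : ℕ+ → LatticeOp) x) := by
  rcases x with n | n
  · exact (commute_latticeShift_zpow _ _).smul_right _
  · exact Commute.zero_right _

theorem commute_latticeShift_zpow_tbarCoeff (k : ℤ) (a : ℕ+ → ℂ) (x : Time) :
    Commute ((latticeShift ^ k : LatticeOpˣ) : LatticeOp)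
      (Sum.elim (0 : ℕ+ → LatticeOp)
        (fun n : ℕ+ => a n • ((latticeShift ^ (-(n : ℤ)) : LatticeOpˣ) : LatticeOp)) x) := by
  rcases x with n | n
  · exact Commute.zero_right _
  · exact (commute_latticeShift_zpow _ _).smul_right _

theorem commute_shift_zpow_tSeries (k : ℤ) (a : ℕ+ → ℂ) :
    Commute ((shift ^ k : TodaOpˣ) : TodaOp) (tSeries a) := by
  rw [shift_zpow, commute_iff_eq, tSeries, C_mul_linearSeries, linearSeries_mul_C]
  congr 1; ext1 x; exact (commute_latticeShift_zpow_tCoeff k a x).eq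

theorem commute_shift_zpow_tbarSeries (k : ℤ) (a : ℕ+ → ℂ) :
    Commute ((shift ^ k : TodaOpˣ) : TodaOp) (tbarSeries a) := by
  rw [shift_zpow, commute_iff_eq, tbarSeries, C_mul_linearSeries, linearSeries_mul_C]
  congr 1; ext1 x; exact (commute_latticeShift_zpow_tbarCoeff k a x).eq

theorem commute_tSeries (a b : ℕ+ → ℂ) : Commute (tSeries a) (tSeries b) := by
  refine commute_linearSeries fun x y => ?_
  rcases x with n | n
  · exact (commute_latticeShift_zpow_tCoeff n b y).smul_left _
  · exact Commute.zero_left _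

theorem commute_tbarSeries (a b : ℕ+ → ℂ) : Commute (tbarSeries a) (tbarSeries b) := by
  refine commute_linearSeries fun x y => ?_
  rcases x with n | n
  · exact Commute.zero_left _
  · exact (commute_latticeShift_zpow_tbarCoeff (-n) b y).smul_left _

theorem position_mul_tSeries_one_sub :
    position * tSeries (fun _ => 1) - tSeries (fun _ => 1) * position =
      -tSeries fun n => (n : ℂ) := by
  rw [position, diag, tSeries, tSeries, C_mul_linearSeries, linearSeries_mul_C, linearSeries_sub,
    linearSeries_neg]
  congr 1; ext1 x
  rcases x with n | n
  · simp only [Sum.elim_inl, one_smul]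
    exact (latticeDiag_mul_latticeShift_zpow_sub n).trans
      (neg_smul (R := ℂ) (M := LatticeOp) _ _)
  · simp only [Sum.elim_inr, Pi.zero_apply, mul_zero, zero_mul]
    exact (sub_self (0 : LatticeOp)).trans (neg_zero (G := LatticeOp)).symm

theorem position_mul_tbarSeries_one_sub :
    position * tbarSeries (fun _ => 1) - tbarSeries (fun _ => 1) * position =
      tbarSeries fun n => (n : ℂ) := by
  rw [position, diag, tbarSeries, tbarSeries, C_mul_linearSeries, linearSeries_mul_C,
    linearSeries_sub]
  congr 1; ext1 x
  rcases x with n | n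
  · simp only [Sum.elim_inl, Pi.zero_apply, mul_zero, zero_mul]
    exact sub_self (0 : LatticeOp)
  · simpa only [Sum.elim_inr, one_smul, Int.cast_neg, neg_neg, Int.cast_natCast] using
      latticeDiag_mul_latticeShift_zpow_sub (-n)

/-! ### The formal exponential -/

/-- The partial sum `∑_{k < N} X^k / k!` of the exponential series. -/
def expSum (X : TodaOp) (N : ℕ) : TodaOp :=
  ∑ k ∈ range N, ((k.factorial : ℂ)⁻¹) • X ^ k

theorem coeff_pow_eq_zero {X : TodaOp} (hX : constantCoeff X = 0) {m : Time →₀ ℕ} {k : ℕ}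
    (h : m.degree < k) : coeff m (X ^ k) = 0 :=
  coeff_of_lt_order <| lt_of_lt_of_le (by exact_mod_cast h)
    (le_order_pow_of_constantCoeff_eq_zero k hX)

/-- Any sufficiently long partial sum will do, so identities for the exponential reduce to finite
sums. -/
theorem coeff_formalExp {X : TodaOp} (hX : constantCoeff X = 0) {m : Time →₀ ℕ} {N : ℕ}
    (h : m.degree < N) : coeff m (formalExp X) = coeff m (expSum X N) := by
  have h1 : coeff m (formalExp X) = ∑ k ∈ range (m.degree + 1),
    ((k.factorial : ℂ)⁻¹) • coeff m (X ^ k) := rfl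
  have h2 : coeff m (expSum X N) = ∑ k ∈ range N, ((k.factorial : ℂ)⁻¹) • coeff m (X ^ k) := by
    simp only [expSum, map_sum]; rfl
  rw [h1, h2]
  refine sum_subset (range_mono h) fun k _ hk => ?_
  rw [coeff_pow_eq_zero hX (by simpa using hk), smul_zero]

theorem constantCoeff_formalExp {X : TodaOp} (hX : constantCoeff X = 0) :
    constantCoeff (formalExp X) = 1 := by
  rw [← coeff_zero_eq_constantCoeff_apply, coeff_formalExp hX (N := 1) (by simp)]
  simp [expSum]

theorem coeff_mul_formalExp {X : TodaOp} (hX : constantCoeff X = 0) (A : TodaOp)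
    {m : Time →₀ ℕ} {N : ℕ} (h : m.degree < N) :
    coeff m (A * formalExp X) = coeff m (A * expSum X N) := by
  classical
  rw [coeff_mul, coeff_mul]
  refine sum_congr rfl fun p hp => ?_
  rw [coeff_formalExp hX (lt_of_le_of_lt ?_ h)]
  rw [← mem_antidiagonal.1 hp, map_add]
  exact Nat.le_add_left _ _

theorem coeff_formalExp_mul {X : TodaOp} (hX : constantCoeff X = 0) (A : TodaOp)
    {m : Time →₀ ℕ} {N : ℕ} (h : m.degree < N) :
    coeff m (formalExp X * A) = coeff m (expSum X N * A) := by
  classical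
  rw [coeff_mul, coeff_mul]
  refine sum_congr rfl fun p hp => ?_
  rw [coeff_formalExp hX (lt_of_le_of_lt ?_ h)]
  rw [← mem_antidiagonal.1 hp, map_add]
  exact Nat.le_add_right _ _

theorem commute_formalExp {X A : TodaOp} (hX : constantCoeff X = 0) (h : Commute A X) :
    Commute A (formalExp X) := by
  refine MvPowerSeries.ext fun m => ?_
  rw [coeff_mul_formalExp hX A m.degree.lt_succ_self, coeff_formalExp_mul hX A m.degree.lt_succ_self]
  congr 1
  exact Commute.sum_right _ _ _ fun k _ => (h.pow_right k).smul_right _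

/-- The commutator with `A` is a derivation, and `B` commutes with `X`, so the power rule holds. -/
theorem mul_pow_sub_of_commutator {R : Type*} [Ring R] {A X B : R} (h : A * X - X * A = B)
    (hB : Commute B X) (k : ℕ) : A * X ^ (k + 1) - X ^ (k + 1) * A = (k + 1) • (B * X ^ k) := by
  induction k with
  | zero => simpa using h
  | succ k ih =>
    have e : A * X ^ (k + 1 + 1) - X ^ (k + 1 + 1) * A =
        (A * X ^ (k + 1) - X ^ (k + 1) * A) * X + X ^ (k + 1) * (A * X - X * A) := by
      simp only [pow_succ]; noncomm_ring
    rw [e, ih, h, (hB.pow_right (k + 1)).symm.eq, smul_mul_assoc, mul_assoc, ← pow_succ,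
      succ_nsmul _ (k + 1)]

theorem mul_sum_pow_sub_of_commutator {R : Type*} [Ring R] [Algebra ℂ R] {A X B : R}
    (h : A * X - X * A = B) (hB : Commute B X) (N : ℕ) :
    A * (∑ k ∈ range (N + 1), ((k.factorial : ℂ)⁻¹) • X ^ k) -
      (∑ k ∈ range (N + 1), ((k.factorial : ℂ)⁻¹) • X ^ k) * A =
      B * ∑ k ∈ range N, ((k.factorial : ℂ)⁻¹) • X ^ k := by
  simp only [mul_sum, sum_mul, mul_smul_comm, smul_mul_assoc, ← sum_sub_distrib, ← smul_sub]
  -- The `k = 0` term has zero commutator; the rest is reindexed, and `(k + 1) / (k + 1)! = 1 / k!`.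
  rw [sum_range_succ', pow_zero, mul_one, one_mul, sub_self, smul_zero, add_zero]
  refine sum_congr rfl fun k _ => ?_
  rw [mul_pow_sub_of_commutator h hB, ← Nat.cast_smul_eq_nsmul ℂ, smul_smul]
  congr 1
  rw [Nat.factorial_succ]
  have : (k.factorial : ℂ) ≠ 0 := by exact_mod_cast k.factorial_ne_zero
  have : (k : ℂ) + 1 ≠ 0 := by exact_mod_cast k.succ_ne_zero
  push_cast
  field_simp

theorem mul_expSum_sub {A X B : TodaOp} (h : A * X - X * A = B) (hB : Commute B X) (N : ℕ) :
    A * expSum X (N + 1) - expSum X (N + 1) * A = B * expSum X N :=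
  mul_sum_pow_sub_of_commutator (R := TodaOp) h hB N

theorem mul_formalExp_sub {A X B : TodaOp} (hX : constantCoeff X = 0) (h : A * X - X * A = B)
    (hB : Commute B X) : A * formalExp X - formalExp X * A = B * formalExp X := by
  refine MvPowerSeries.ext fun m => ?_
  -- Taking the commutator shortens the partial sum by one term, so the left side starts one term
  -- longer.
  rw [map_sub, coeff_mul_formalExp hX A (N := m.degree + 1 + 1) (by omega),
    coeff_formalExp_mul hX A (N := m.degree + 1 + 1) (by omega),
    coeff_mul_formalExp hX B m.degree.lt_succ_self, ← map_sub, mul_expSum_sub h hB]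

/-! ### The Gauss decomposition -/

theorem entry_apply (A : TodaOp) (i j : ℤ) (m : Time →₀ ℕ) :
    coeff m (entry A i j) = (coeff m A) (Finsupp.single j 1) i := rfl

theorem entry_eq_zero_iff {A : TodaOp} {i j : ℤ} :
    entry A i j = 0 ↔ ∀ m, (coeff m A) (Finsupp.single j 1) i = 0 := by
  rw [MvPowerSeries.ext_iff]; rfl

theorem entry_eq_one_iff {A : TodaOp} {i j : ℤ} :
    entry A i j = 1 ↔ ∀ m, (coeff m A) (Finsupp.single j 1) i = if m = 0 then 1 else 0 := by
  classical
  simp only [MvPowerSeries.ext_iff, coeff_one, entry_apply]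

/-- The test `p.1 < m` discards only the pair `(m, 0)`. This isolates the top coefficient of `W` and
leaves a sum suited to well-founded recursion. -/
theorem coeff_mul_eq_add_sum (W U : TodaOp) (m : Time →₀ ℕ) [DecidableEq Time] :
    coeff m (W * U) = coeff m W * constantCoeff U +
      ∑ p ∈ antidiagonal m, if p.1 < m then coeff p.1 W * coeff p.2 U else 0 := by
  have hm : (m, (0 : Time →₀ ℕ)) ∈ antidiagonal m := by simp
  rw [coeff_mul, ← add_sum_erase _ _ hm, ← add_sum_erase (antidiagonal m) (fun p => ite _ _ _) hm,
    if_neg (lt_irrefl _), zero_add, coeff_zero_eq_constantCoeff_apply]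
  congr 1
  refine sum_congr rfl fun p hp => ?_
  obtain ⟨h1, h2⟩ := mem_erase.1 hp
  obtain ⟨a, b⟩ := p
  obtain rfl : a + b = m := HasAntidiagonal.mem_antidiagonal.1 h2
  refine (if_pos (lt_add_of_pos_right _ (pos_iff_ne_zero.2 ?_))).symm
  rintro rfl
  simp at h1

/-- The lower unitriangular factor `W` for which `W U` is upper triangular, when the constant
coefficient of `U` is the diagonal matrix with inverse `E`; defined by recursion on the
coefficients. -/
def lowerFactor (E : LatticeOp) (U : TodaOp) : TodaOp
  | m =>
    letI := Classical.decEq Time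
    if m = 0 then 1
    else
      -(lowerPart (∑ p ∈ antidiagonal m,
        if _ : p.1 < m then lowerFactor E U p.1 * coeff p.2 U else 0) * E)
termination_by m => m

theorem coeff_lowerFactor [DecidableEq Time] (E : LatticeOp) (U : TodaOp) (m : Time →₀ ℕ) :
    coeff m (lowerFactor E U) = if m = 0 then 1 else
      -(lowerPart (∑ p ∈ antidiagonal m,
        if p.1 < m then coeff p.1 (lowerFactor E U) * coeff p.2 U else 0) * E) := by
  change lowerFactor E U m = _
  -- The antidiagonal depends on the decidability instance, and the recursion was defined with the
  -- classical one.
  cases Subsingleton.elim ‹DecidableEq Time› (Classical.decEq Time)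
  rw [lowerFactor]
  rfl

theorem neg_mul_mul_of_mul_eq_one {R : Type*} [Ring R] {E D : R} (h : E * D = 1) (A : R) :
    -(A * E) * D = -A := by
  rw [neg_mul, mul_assoc, h, mul_one]

section Gauss

variable {d : ℤ → ℂ} {U : TodaOp}

theorem entry_lowerFactor (e : ℤ → ℂ) (U : TodaOp) {i j : ℤ} (h : i ≤ j) :
    entry (lowerFactor (latticeDiag e) U) i j = if i = j then 1 else 0 := by
  classical
  have key (m : Time →₀ ℕ) : (coeff m (lowerFactor (latticeDiag e) U)) (Finsupp.single j 1) i =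
      if m = 0 then (if i = j then 1 else 0) else 0 := by
    rw [coeff_lowerFactor]
    by_cases hm : m = 0
    · rw [if_pos hm, if_pos hm, Module.End.one_apply, Finsupp.single_apply]
      simp only [eq_comm]
    · rw [if_neg hm, if_neg hm, LinearMap.neg_apply, Finsupp.neg_apply, mul_latticeDiag_single,
        lowerPart_single, if_neg h.not_gt, mul_zero, neg_zero]
  split_ifs with hij
  · exact entry_eq_one_iff.2 fun m => by rw [key m, if_pos hij]
  · exact entry_eq_zero_iff.2 fun m => by rw [key m, if_neg hij, ite_self]

theorem entry_lowerFactor_mul (hd : ∀ i, d i ≠ 0) (hU : constantCoeff U = latticeDiag d)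
    {i j : ℤ} (h : j < i) :
    entry (lowerFactor (latticeDiag fun i => (d i)⁻¹) U * U) i j = 0 := by
  classical
  refine entry_eq_zero_iff.2 fun m => ?_
  rw [coeff_mul_eq_add_sum, coeff_lowerFactor, hU]
  by_cases hm : m = 0
  · subst hm
    simp [latticeDiag_single, h.ne]
  · rw [if_neg hm, LinearMap.add_apply,
      neg_mul_mul_of_mul_eq_one (R := LatticeOp) (latticeDiag_inv_mul hd), LinearMap.neg_apply, Finsupp.add_apply, Finsupp.neg_apply, lowerPart_single, if_pos h,
      neg_add_cancel]

/-- By induction on `m`: entries on and above the diagonal are prescribed, and below it the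
vanishing of the product fixes `d_j` times the entry in terms of lower coefficients. -/
theorem eq_of_mul_upper (hd : ∀ i, d i ≠ 0) (hU : constantCoeff U = latticeDiag d) {V W : TodaOp}
    (hV : ∀ i j, i < j → entry V i j = 0) (hV1 : ∀ i, entry V i i = 1)
    (hVU : ∀ i j, j < i → entry (V * U) i j = 0)
    (hW : ∀ i j, i < j → entry W i j = 0) (hW1 : ∀ i, entry W i i = 1)
    (hWU : ∀ i j, j < i → entry (W * U) i j = 0) : V = W := by
  classical
  refine MvPowerSeries.ext fun m => ?_
  induction m using WellFoundedLT.induction with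
  | ind m ih =>
  refine latticeOp_ext fun i j => ?_
  rcases lt_trichotomy i j with h | rfl | h
  · rw [entry_eq_zero_iff.1 (hV i j h) m, entry_eq_zero_iff.1 (hW i j h) m]
  · rw [entry_eq_one_iff.1 (hV1 i) m, entry_eq_one_iff.1 (hW1 i) m]
  · have h1 := entry_eq_zero_iff.1 (hVU i j h) m
    have h2 := entry_eq_zero_iff.1 (hWU i j h) m
    rw [coeff_mul_eq_add_sum, hU, LinearMap.add_apply, Finsupp.add_apply,
      mul_latticeDiag_single] at h1 h2
    have h3 : (∑ p ∈ antidiagonal m, if p.1 < m then coeff p.1 V * coeff p.2 U else 0) =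
        ∑ p ∈ antidiagonal m, if p.1 < m then coeff p.1 W * coeff p.2 U else 0 :=
      sum_congr rfl fun p _ => by split_ifs with hp <;> [rw [ih _ hp]; rfl]
    rw [h3] at h1
    exact mul_left_cancel₀ (hd j) (add_right_cancel (h1.trans h2.symm))

end Gauss

/-! ### Time evolution -/

theorem coeff_algebra_smul {σ R : Type*} [Semiring R] [Algebra ℂ R] (c : ℂ) (f : MvPowerSeries σ R)
    (m : σ →₀ ℕ) : coeff m (c • f) = c • coeff m f := rfl

theorem constantCoeff_smul_eq_zero {σ R : Type*} [Semiring R] [Algebra ℂ R] (c : ℂ)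
    {f : MvPowerSeries σ R} (h : constantCoeff f = 0) : constantCoeff (c • f) = 0 := by
  rw [← coeff_zero_eq_constantCoeff_apply] at h ⊢
  rw [coeff_algebra_smul, h, smul_zero]

theorem constantCoeff_neg_eq_zero {σ R : Type*} [Ring R] {f : MvPowerSeries σ R}
    (h : constantCoeff f = 0) : constantCoeff (-f) = 0 := by
  rw [map_neg, h, neg_zero]

theorem constantCoeff_smul_tSeries (c : ℂ) (a : ℕ+ → ℂ) : constantCoeff (c • tSeries a) = 0 :=
  constantCoeff_smul_eq_zero c (constantCoeff_linearSeries _)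

theorem constantCoeff_neg_smul_tbarSeries (c : ℂ) (a : ℕ+ → ℂ) :
    constantCoeff (-(c • tbarSeries a)) = 0 :=
  constantCoeff_neg_eq_zero (R := LatticeOp)
    (constantCoeff_smul_eq_zero c (constantCoeff_linearSeries _))

theorem constantCoeff_evolve (ħ : ℂ) (d : ℤ → ℂ) :
    constantCoeff (evolve ħ (diag d)) = latticeDiag d := by
  rw [evolve, map_mul, map_mul, constantCoeff_formalExp (constantCoeff_smul_tSeries _ _),
    constantCoeff_formalExp (constantCoeff_neg_smul_tbarSeries _ _), one_mul, mul_one, diag,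
    constantCoeff_C]

theorem isDressing_iff {ħ : ℂ} {U₀ : TodaOp} {W Wbar : TodaOpˣ} :
    IsDressing ħ U₀ W Wbar ↔ (∀ i j : ℤ, i < j → entry W i j = 0) ∧ (∀ i : ℤ, entry W i i = 1) ∧
      (∀ i j : ℤ, j < i → entry Wbar i j = 0) ∧ (W : TodaOp) * evolve ħ U₀ = Wbar := by
  refine ⟨fun h => ⟨h.lower, h.diag_one, h.upper, ?_⟩, fun h => ⟨h.1, h.2.1, h.2.2.1, ?_⟩⟩
  · rw [h.factor, Units.mul_inv_cancel_left]
  · rw [← h.2.2.2, Units.inv_mul_cancel_left]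

/-- Existence and uniqueness of the dressing operators for an invertible diagonal initial
value. -/
theorem existsUnique_isDressing (ħ : ℂ) {d : ℤ → ℂ} (hd : ∀ i, d i ≠ 0) :
    ∃! p : TodaOpˣ × TodaOpˣ, IsDressing ħ (diag d) p.1 p.2 := by
  classical
  have hU := constantCoeff_evolve ħ d
  -- Only the constant coefficient of `U` matters; it also makes `U` and the lower factor units.
  have key (U : TodaOp) (hU : constantCoeff U = latticeDiag d) :
      ∃! p : TodaOpˣ × TodaOpˣ, (∀ i j : ℤ, i < j → entry p.1 i j = 0) ∧
        (∀ i : ℤ, entry p.1 i i = 1) ∧ (∀ i j : ℤ, j < i → entry p.2 i j = 0) ∧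
        (p.1 : TodaOp) * U = p.2 := by
    obtain ⟨u, hu⟩ : IsUnit U := (isUnit_iff_constantCoeff (R := LatticeOp)).2
      (by rw [hU]; exact isUnit_latticeDiag hd)
    have hV0 : constantCoeff (lowerFactor (latticeDiag fun i => (d i)⁻¹) U) = 1 := by
      rw [← coeff_zero_eq_constantCoeff_apply, coeff_lowerFactor, if_pos rfl]
    obtain ⟨v, hv⟩ : IsUnit (lowerFactor (latticeDiag fun i => (d i)⁻¹) U) :=
      (isUnit_iff_constantCoeff (R := LatticeOp)).2 (by rw [hV0]; exact isUnit_one)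
    have hl : ∀ i j, i < j → entry v i j = 0 := fun i j h => by
      rw [hv, entry_lowerFactor _ _ h.le, if_neg h.ne]
    have h1 : ∀ i, entry v i i = 1 := fun i => by
      rw [hv, entry_lowerFactor _ _ le_rfl, if_pos rfl]
    have hvu : ∀ i j, j < i → entry (v * U) i j = 0 := fun i j h => by
      rw [hv]; exact entry_lowerFactor_mul hd hU h
    have huv : ((v * u : TodaOpˣ) : TodaOp) = v * U := by rw [Units.val_mul, hu]
    refine ⟨(v, v * u), ⟨hl, h1, fun i j h => ?_, huv.symm⟩, ?_⟩
    · rw [huv]; exact hvu i j h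
    · rintro ⟨W, Wbar⟩ ⟨h2, h3, h4, h5⟩
      have hW : W = v := Units.ext <|
        eq_of_mul_upper hd hU h2 h3 (fun i j h => by rw [h5]; exact h4 i j h) hl h1 hvu
      refine Prod.ext hW (Units.ext ?_)
      rw [huv, ← hW]
      exact h5.symm
  simpa only [isDressing_iff] using key _ hU

/-! ### String equations -/

section Algebra

variable {R : Type*} [Ring R] [Algebra ℂ R]

theorem smul_mul_inv_smul_sub {c : ℂ} (hc : c ≠ 0) {P X Y : R} (h : P * X - X * P = Y) :
    (c • P) * (c⁻¹ • X) - (c⁻¹ • X) * (c • P) = Y := by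
  rw [smul_mul_smul_comm, smul_mul_smul_comm, mul_inv_cancel₀ hc, inv_mul_cancel₀ hc, one_smul,
    one_smul, h]

theorem smul_mul_neg_inv_smul_sub {c : ℂ} (hc : c ≠ 0) {P X Y : R} (h : P * X - X * P = Y) :
    (c • P) * (-(c⁻¹ • X)) - (-(c⁻¹ • X)) * (c • P) = -Y := by
  rw [← smul_mul_inv_smul_sub hc h, mul_neg, neg_mul, neg_sub', sub_neg_eq_add]

theorem mul_eq_add_mul_of_sub {S : Type*} [Ring S] {P X Y : S} (h : P * X - X * P = -Y * X) :
    X * P = (P + Y) * X := by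
  rw [add_mul, ← sub_eq_iff_eq_add', ← neg_sub, h, neg_mul, neg_neg]

theorem mul_eq_mul_sub_of_sub {S : Type*} [Ring S] {P X Y : S} (h : P * X - X * P = -Y * X)
    (hc : Commute (-Y) X) :
    P * X = X * (P - Y) := by
  rw [sub_eq_iff_eq_add.1 h, hc.eq, mul_neg, mul_sub, neg_add_eq_sub]

theorem commute_neg_left_smul_right (c : ℂ) {X Y : R} (h : Commute Y X) : Commute (-Y) (c • X) :=
  (h.smul_right c).neg_left

theorem commute_neg_left_neg_smul_right (c : ℂ) {X Y : R} (h : Commute Y X) :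
    Commute (-Y) (-(c • X)) :=
  (h.smul_right c).neg_left.neg_right

theorem commute_neg_smul_right (c : ℂ) {X Y : R} (h : Commute Y X) : Commute Y (-(c • X)) :=
  (h.smul_right c).neg_right

theorem C_affine {σ : Type*} (a b c : ℂ) (x : R) :
    (C (-(b • (a • x)) + c • 1 + 1) : MvPowerSeries σ R) = -(b • (a • C x)) + c • 1 + 1 := by
  classical
  have hs (a : ℂ) (A : R) : (C (a • A) : MvPowerSeries σ R) = a • C A := by
    refine MvPowerSeries.ext fun m => ?_
    rw [coeff_algebra_smul, coeff_C, coeff_C, smul_ite, smul_zero]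
  rw [map_add, map_add, map_neg, hs, hs, hs, map_one]

/-- Dressing of the relation `S U = U (-b Q - c + 1) S` with `U = E D F = W⁻¹ W̄`. -/
theorem dressed_mul_right {S W V : Rˣ} {E D F P Q : R} {b c : ℂ} (hE : Commute (S : R) E)
    (hF : Commute (S : R) F) (hD : S * D = D * (-(b • P) + (-c) • 1 + 1) * S) (hP : P * F = F * Q)
    (hV : W * (E * D * F) = (V : R)) :
    ((W * S * W⁻¹ : Rˣ) : R) = (-(b • (V * Q * ((V⁻¹ : Rˣ) : R))) - c • 1 + 1) *
      ((V * S * V⁻¹ : Rˣ) : R) := by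
  have h5 : (-(b • P) + (-c) • 1 + 1) * F = F * (-(b • Q) + (-c) • 1 + 1) := by
    simp only [add_mul, mul_add, neg_mul, mul_neg, smul_mul_assoc, mul_smul_comm, hP, one_mul,
      mul_one]
  have h6 : (-(b • (V * Q * ((V⁻¹ : Rˣ) : R))) - c • 1 + 1) * (V : R) =
      V * (-(b • Q) + (-c) • 1 + 1) := by
    simp only [add_mul, mul_add, neg_mul, mul_neg, smul_mul_assoc, mul_smul_comm, one_mul,
      mul_one, Units.inv_mul_cancel_right, neg_smul, sub_eq_add_neg]
  have h7 : (W : R) * S * (E * D * F) = V * (-(b • Q) + (-c) • 1 + 1) * S := by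
    calc (W : R) * S * (E * D * F) = W * (S * E) * D * F := by simp only [mul_assoc]
      _ = W * E * (S * D) * F := by rw [hE.eq]; simp only [mul_assoc]
      _ = W * E * D * (-(b • P) + (-c) • 1 + 1) * (S * F) := by rw [hD]; simp only [mul_assoc]
      _ = W * E * D * ((-(b • P) + (-c) • 1 + 1) * F) * S := by rw [hF.eq]; simp only [mul_assoc]
      _ = V * (-(b • Q) + (-c) • 1 + 1) * S := by rw [h5, ← hV]; simp only [mul_assoc]
  -- Multiplied on the right by `V = W E D F`, the goal becomes `h7`.
  rw [← Units.mul_left_inj V]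
  simp only [Units.val_mul]
  rw [← mul_assoc, ← mul_assoc, h6, Units.inv_mul_cancel_right, ← h7, ← hV]
  simp only [mul_assoc, Units.inv_mul_cancel_left]

/-- Dressing of the relation `U S = (-b Q + c + 1) S U` with `U = E D F = W⁻¹ W̄`. -/
theorem dressed_mul_left {S W V : Rˣ} {E D F P Q : R} {b c : ℂ} (hE : Commute (S : R) E)
    (hF : Commute (S : R) F) (hD : D * S = (-(b • P) + c • 1 + 1) * S * D) (hP : E * P = Q * E)
    (hV : W * (E * D * F) = (V : R)) :
    ((V * S * V⁻¹ : Rˣ) : R) = (-(b • (W * Q * ((W⁻¹ : Rˣ) : R))) + c • 1 + 1) *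
      ((W * S * W⁻¹ : Rˣ) : R) := by
  have h5 : E * (-(b • P) + c • 1 + 1) = (-(b • Q) + c • 1 + 1) * E := by
    simp only [add_mul, mul_add, neg_mul, mul_neg, smul_mul_assoc, mul_smul_comm, hP, one_mul,
      mul_one]
  have h6 : (-(b • (W * Q * ((W⁻¹ : Rˣ) : R))) + c • 1 + 1) * (W : R) =
      W * (-(b • Q) + c • 1 + 1) := by
    simp only [add_mul, mul_add, neg_mul, mul_neg, smul_mul_assoc, mul_smul_comm, one_mul,
      mul_one, Units.inv_mul_cancel_right]
  have h7 : E * D * F * (S : R) = (-(b • Q) + c • 1 + 1) * S * (E * D * F) := by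
    calc E * D * F * (S : R) = E * D * (S * F) := by rw [hF.eq]; simp only [mul_assoc]
      _ = E * (D * S) * F := by simp only [mul_assoc]
      _ = E * (-(b • P) + c • 1 + 1) * S * D * F := by rw [hD]; simp only [mul_assoc]
      _ = (-(b • Q) + c • 1 + 1) * (E * S) * D * F := by rw [h5]; simp only [mul_assoc]
      _ = (-(b • Q) + c • 1 + 1) * S * (E * D * F) := by rw [← hE.eq]; simp only [mul_assoc]
  rw [← Units.mul_left_inj V]
  simp only [Units.val_mul]
  rw [Units.inv_mul_cancel_right, ← mul_assoc, ← mul_assoc, h6, ← hV]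
  rw [mul_assoc (W : R), h7]
  simp only [mul_assoc, Units.inv_mul_cancel_left]

end Algebra

/-! ### Moving shifts and position through the exponentials -/

theorem commute_evolve_left (ħ : ℂ) (k : ℤ) :
    Commute ((shift ^ k : TodaOpˣ) : TodaOp) (formalExp (ħ⁻¹ • tSeries fun _ => 1)) :=
  commute_formalExp (constantCoeff_smul_tSeries _ _)
    (Commute.smul_right (commute_shift_zpow_tSeries k _) _)

theorem commute_evolve_right (ħ : ℂ) (k : ℤ) :
    Commute ((shift ^ k : TodaOpˣ) : TodaOp) (formalExp (-(ħ⁻¹ • tbarSeries fun _ => 1))) :=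
  commute_formalExp (constantCoeff_neg_smul_tbarSeries _ _)
    (commute_neg_smul_right (R := TodaOp) _ (commute_shift_zpow_tbarSeries k _))

/-- The commutator of `s` with the exponent is `-∑ n t_n Λ^n`, the factors of `ħ` cancelling. It
commutes with the exponent, so there are no further correction terms. -/
theorem formalExp_tSeries_mul_position {ħ : ℂ} (hħ : ħ ≠ 0) :
    formalExp (ħ⁻¹ • tSeries fun _ => 1) * (ħ • position) =
      (ħ • position + tSeries fun n => (n : ℂ)) * formalExp (ħ⁻¹ • tSeries fun _ => 1) :=
  mul_eq_add_mul_of_sub (S := TodaOp) <| mul_formalExp_sub (constantCoeff_smul_tSeries _ _)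
    (smul_mul_inv_smul_sub (R := TodaOp) hħ position_mul_tSeries_one_sub)
    (commute_neg_left_smul_right (R := TodaOp) _ (commute_tSeries _ _))

theorem position_mul_formalExp_tbarSeries {ħ : ℂ} (hħ : ħ ≠ 0) :
    (ħ • position) * formalExp (-(ħ⁻¹ • tbarSeries fun _ => 1)) =
      formalExp (-(ħ⁻¹ • tbarSeries fun _ => 1)) *
        (ħ • position - tbarSeries fun n => (n : ℂ)) :=
  have hX := constantCoeff_neg_smul_tbarSeries ħ⁻¹ fun _ => 1
  have hB := commute_neg_left_neg_smul_right (R := TodaOp) ħ⁻¹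
    (commute_tbarSeries (fun n => (n : ℂ)) fun _ => 1)
  mul_eq_mul_sub_of_sub (S := TodaOp) (mul_formalExp_sub hX
    (smul_mul_neg_inv_smul_sub (R := TodaOp) hħ position_mul_tbarSeries_one_sub) hB)
    (commute_formalExp hX hB)

/-! ### The Gamma function initial value -/

section String

variable {β : ℤ} {ħ ℓ : ℂ}

theorem stringEntry_ne_zero
    (hnum : ∀ (i : ℤ) (n : ℕ), 1 / 2 - 1 / ħ + ((i : ℂ) + 1 / 2) / (β : ℂ) ≠ -(n : ℂ))
    (hden : ∀ n : ℕ, 1 / 2 - 1 / ħ ≠ -(n : ℂ)) (i : ℤ) : stringEntry β ħ ℓ i ≠ 0 :=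
  mul_ne_zero (Complex.exp_ne_zero _)
    (div_ne_zero (Complex.Gamma_ne_zero (hnum i)) (Complex.Gamma_ne_zero hden))

theorem stringEntry_add (hβ : β ≠ 0) (hℓ : Complex.exp ℓ = -ħ)
    (hnum : ∀ (i : ℤ) (n : ℕ), 1 / 2 - 1 / ħ + ((i : ℂ) + 1 / 2) / (β : ℂ) ≠ -(n : ℂ)) (i : ℤ) :
    stringEntry β ħ ℓ (i + β) =
      stringEntry β ħ ℓ i * (-(ħ * i / β) - ħ * ((β : ℂ) + 1) / (2 * β) + 1) := by
  have hβ' : (β : ℂ) ≠ 0 := by exact_mod_cast hβ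
  have hħ : ħ ≠ 0 := fun h => Complex.exp_ne_zero ℓ (by rw [hℓ, h, neg_zero])
  have hs : ((i : ℂ) + β + 1 / 2) / β = ((i : ℂ) + 1 / 2) / β + 1 := by field_simp; ring
  -- The case `n = 0` is the condition `z ≠ 0` needed for `Γ(z + 1) = z Γ(z)`.
  have h0 := hnum i 0
  rw [Nat.cast_zero, neg_zero] at h0
  rw [stringEntry, stringEntry, Int.cast_add, hs, ← add_assoc, Complex.Gamma_add_one _ h0, add_mul,
    one_mul, Complex.exp_add, hℓ]
  have : -(ħ * i / β) - ħ * ((β : ℂ) + 1) / (2 * β) + 1 =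
      -ħ * (1 / 2 - 1 / ħ + ((i : ℂ) + 1 / 2) / β) := by field_simp; ring
  rw [this]
  ring

/-- The scalar operators in the string equations, written with multiplication by `s = ħ i`. -/
theorem C_latticeDiag_affine (ħ b c : ℂ) :
    diag (fun i => -(ħ * i / b) + c + 1) =
      -((1 / b) • (ħ • position)) + c • (1 : TodaOp) + 1 := by
  have h : latticeDiag (fun i => -(ħ * i / b) + c + 1) =
      -((1 / b) • (ħ • latticeDiag fun i => (i : ℂ))) + c • (1 : LatticeOp) + 1 :=
    LinearMap.ext fun f => Finsupp.ext fun i => by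
      simp only [latticeDiag_apply, LinearMap.add_apply, LinearMap.neg_apply, LinearMap.smul_apply,
        Finsupp.add_apply, Finsupp.neg_apply, Finsupp.smul_apply, Module.End.one_apply, smul_eq_mul]
      ring
  rw [diag, h]
  exact C_affine (R := LatticeOp) _ _ _ _

theorem shift_zpow_mul_stringEntry (hβ : β ≠ 0) (hℓ : Complex.exp ℓ = -ħ)
    (hnum : ∀ (i : ℤ) (n : ℕ), 1 / 2 - 1 / ħ + ((i : ℂ) + 1 / 2) / (β : ℂ) ≠ -(n : ℂ)) :
    ((shift ^ β : TodaOpˣ) : TodaOp) * diag (stringEntry β ħ ℓ) =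
      diag (stringEntry β ħ ℓ) * (-((1 / (β : ℂ)) • (ħ • position)) +
        (-(ħ * ((β : ℂ) + 1) / (2 * β))) • (1 : TodaOp) + 1) * ((shift ^ β : TodaOpˣ) : TodaOp) := by
  rw [← C_latticeDiag_affine, shift_zpow, diag, diag, ← map_mul, ← map_mul, ← map_mul,
    latticeShift_zpow_mul_latticeDiag, latticeDiag_mul]
  simp only [stringEntry_add hβ hℓ hnum, sub_eq_add_neg]

theorem stringEntry_mul_shift_zpow (hβ : β ≠ 0) (hℓ : Complex.exp ℓ = -ħ)
    (hnum : ∀ (i : ℤ) (n : ℕ), 1 / 2 - 1 / ħ + ((i : ℂ) + 1 / 2) / (β : ℂ) ≠ -(n : ℂ)) :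
    diag (stringEntry β ħ ℓ) * ((shift ^ (-β) : TodaOpˣ) : TodaOp) =
      (-((1 / (β : ℂ)) • (ħ • position)) +
        (ħ * ((β : ℂ) - 1) / (2 * β)) • (1 : TodaOp) + 1) *
        ((shift ^ (-β) : TodaOpˣ) : TodaOp) * diag (stringEntry β ħ ℓ) := by
  have hβ' : (β : ℂ) ≠ 0 := by exact_mod_cast hβ
  rw [← C_latticeDiag_affine, shift_zpow, diag, diag, ← map_mul, ← map_mul, ← map_mul, mul_assoc,
    latticeShift_zpow_mul_latticeDiag, ← mul_assoc, latticeDiag_mul]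
  congr 3
  funext i
  -- The recurrence is used at `i - β`; this adds `ħ` to the affine factor, and `ħ - ħ(β + 1)/(2β) =
  -- ħ(β - 1)/(2β)`.
  have h := stringEntry_add hβ hℓ hnum (i + -β)
  rw [neg_add_cancel_right] at h
  rw [h, mul_comm]
  congr 1
  push_cast
  field_simp
  ring

/-- Conjugation is a group automorphism, so negative powers are covered too. -/
theorem lax_zpow (W : TodaOpˣ) (k : ℤ) : lax W ^ k = W * shift ^ k * W⁻¹ := by
  rw [lax, ← MulAut.conj_apply, ← map_zpow, MulAut.conj_apply]

end String

end TodaString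
end

theorem mainTheorem4 (β : ℤ) (hβ : β ≠ 0) (ħ ℓ : ℂ) (hℓ : Complex.exp ℓ = -ħ)
    (hnum : ∀ (i : ℤ) (n : ℕ), 1 / 2 - 1 / ħ + ((i : ℂ) + 1 / 2) / (β : ℂ) ≠ -(n : ℂ))
    (hden : ∀ n : ℕ, 1 / 2 - 1 / ħ ≠ -(n : ℂ)) :
    (∃! p : TodaString.TodaOpˣ × TodaString.TodaOpˣ,
      TodaString.IsDressing ħ (TodaString.diag (TodaString.stringEntry β ħ ℓ)) p.1 p.2) ∧
    ∀ W Wbar : TodaString.TodaOpˣ,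
      TodaString.IsDressing ħ (TodaString.diag (TodaString.stringEntry β ħ ℓ)) W Wbar →
        ((TodaString.lax W ^ β : TodaString.TodaOpˣ) : TodaString.TodaOp) =
            (-((1 / (β : ℂ)) • TodaString.orlovMbar ħ Wbar)
              - (ħ * ((β : ℂ) + 1) / (2 * (β : ℂ))) • (1 : TodaString.TodaOp) + 1) *
              ((TodaString.lax Wbar ^ β : TodaString.TodaOpˣ) : TodaString.TodaOp) ∧
        ((TodaString.lax Wbar ^ (-β) : TodaString.TodaOpˣ) : TodaString.TodaOp) =
            (-((1 / (β : ℂ)) • TodaString.orlovM ħ W)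
              + (ħ * ((β : ℂ) - 1) / (2 * (β : ℂ))) • (1 : TodaString.TodaOp) + 1) *
              ((TodaString.lax W ^ (-β) : TodaString.TodaOpˣ) : TodaString.TodaOp) := by
  have hħ : ħ ≠ 0 := fun h => Complex.exp_ne_zero ℓ (by rw [hℓ, h, neg_zero])
  refine ⟨TodaString.existsUnique_isDressing ħ (TodaString.stringEntry_ne_zero hnum hden),
    fun W Wbar h => ?_⟩
  have hW := (TodaString.isDressing_iff.1 h).2.2.2
  rw [TodaString.lax_zpow, TodaString.lax_zpow, TodaString.lax_zpow, TodaString.lax_zpow]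
  -- The first equation moves `s` right through the `t̄` exponential, giving `M̄`; the second moves
  -- it left through the `t` exponential, giving `M`.
  exact ⟨TodaString.dressed_mul_right (R := TodaString.TodaOp)
      (TodaString.commute_evolve_left ħ β) (TodaString.commute_evolve_right ħ β)
      (TodaString.shift_zpow_mul_stringEntry hβ hℓ hnum)
      (TodaString.position_mul_formalExp_tbarSeries hħ) hW,
    TodaString.dressed_mul_left (R := TodaString.TodaOp)
      (TodaString.commute_evolve_left ħ (-β)) (TodaString.commute_evolve_right ħ (-β))
      (TodaString.stringEntry_mul_shift_zpow hβ hℓ hnum)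
      (TodaString.formalExp_tSeries_mul_position hħ) hW⟩
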